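/- Let $R$ be an integral domain with quotient field $K$. For a nonzero fractional ideal $I$ put $I^{-1}=\{x\in K: xI\subseteq R\}$, $I_v=(I^{-1})^{-1}$ and $I_t=\bigcup\{J_v : J\subseteq I,\ J \text{ a nonzero finitely generated fractional ideal}\}$. A nonzero ideal $I\subseteq R$ is a $t$-ideal if $I_t=I$, and is $t$-invertible if $(II^{-1})_t=R$; ideals $I,J$ are $t$-comaximal if $(I+J)_t=R$. A packet is a $t$-invertible $t$-ideal $I\subseteq R$ with exactly one minimal prime. $R$ is a URD if every $t$-invertible $t$-ideal $I\subsetneq R$ can be written, uniquely up to the order of the factors, as $I=(X_1X_2\cdots X_n)_t$ with mutually $t$-comaximal packets $X_1,\dots,X_n$. $R$ is a PVMD if every nonzero finitely generated ideal of $R$ is $t$-invertible, and a ring of Krull type if it is a PVMD in which every nonzero element lies in at most finitely many $t$-maximal ideals (maximal elements of the set of proper integral $t$-ideals). Then: (1) If $R$ is a PVMD, then $R$ is a URD if and only if every nonzero principal ideal of $R$ has at most finitely many minimal primes. (2) If $R$ is a ring of Krull type, then $R$ is a URD. (3) If $R$ is a GCD domain, then $R$ is a URD if and only if every nonzero proper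 principal ideal of $R$ is a finite product of packets. -/

import Mathlib

open scoped nonZeroDivisors

namespace TFactor

section Closures

variable {R : Type*} [CommRing R] [IsDomain R]
variable {K : Type*} [Field K] [Algebra R K] [IsFractionRing R K]

/-- The `v`-closure `I_v = (I⁻¹)⁻¹` of a fractional ideal, where `I⁻¹ = (R : I)`
(with Mathlib's convention `0⁻¹ = 0`, so `0_v = 0`). -/
noncomputable def vClosure (I : FractionalIdeal R⁰ K) : FractionalIdeal R⁰ K := (I⁻¹)⁻¹

theorem vClosure_mono {I J : FractionalIdeal R⁰ K} (h : I ≤ J) : vClosure I ≤ vClosure J := by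
  unfold vClosure
  by_cases hI : I = 0
  · subst hI
    simp [FractionalIdeal.inv_zero']
  have hJ : J ≠ 0 := fun h0 => hI (le_antisymm (h0 ▸ h) (FractionalIdeal.zero_le I))
  by_cases hJ' : J⁻¹ = 0
  · exfalso
    obtain ⟨a, ha, haJ⟩ := J.isFractional
    have hmem : algebraMap R K a ∈ J⁻¹ := by
      rw [FractionalIdeal.mem_inv_iff hJ]
      intro y hy
      obtain ⟨r, hr⟩ := haJ y hy
      rw [FractionalIdeal.mem_one_iff]
      exact ⟨r, by rw [hr, Algebra.smul_def]⟩
    rw [hJ', FractionalIdeal.mem_zero_iff] at hmem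
    exact nonZeroDivisors.ne_zero ha ((IsFractionRing.to_map_eq_zero_iff (K := K)).mp hmem)
  have h1 : J⁻¹ ≤ I⁻¹ := FractionalIdeal.inv_anti_mono hI hJ h
  have hI' : I⁻¹ ≠ 0 := fun h0 => hJ' (le_antisymm (h0 ▸ h1) (FractionalIdeal.zero_le _))
  exact FractionalIdeal.inv_anti_mono hJ' hI' h1

/-- The `t`-closure `I_t`: the union of the `J_v`, where `J` runs over the finitely generated
fractional ideals contained in `I` (`J = 0` contributes only `0`). -/
noncomputable def tClosure (I : FractionalIdeal R⁰ K) : FractionalIdeal R⁰ K :=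
  ⟨{ carrier := {x | ∃ J : FractionalIdeal R⁰ K,
        J ≤ I ∧ (J : Submodule R K).FG ∧ x ∈ vClosure J}
     zero_mem' := ⟨0, FractionalIdeal.zero_le I, by
        rw [FractionalIdeal.coe_zero]; exact Submodule.fg_bot, Submodule.zero_mem _⟩
     add_mem' := by
        rintro x y ⟨J, hJ, hJfg, hx⟩ ⟨L, hL, hLfg, hy⟩
        refine ⟨J ⊔ L, sup_le hJ hL, ?_, ?_⟩
        · rw [FractionalIdeal.coe_sup]; exact hJfg.sup hLfg
        · exact Submodule.add_mem _ (vClosure_mono le_sup_left hx) (vClosure_mono le_sup_right hy)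
     smul_mem' := by
        rintro c x ⟨J, hJ, hJfg, hx⟩
        exact ⟨J, hJ, hJfg, Submodule.smul_mem _ c hx⟩ }, by
    obtain ⟨a, ha, h⟩ := (vClosure I).isFractional
    refine ⟨a, ha, ?_⟩
    rintro x ⟨J, hJ, -, hx⟩
    exact h x (vClosure_mono hJ hx)⟩

theorem mem_tClosure {I : FractionalIdeal R⁰ K} {x : K} :
    x ∈ tClosure I ↔ ∃ J : FractionalIdeal R⁰ K,
      J ≤ I ∧ (J : Submodule R K).FG ∧ x ∈ vClosure J := Iff.rfl

end Closures

variable {R : Type*} [CommRing R] [IsDomain R]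
variable (K : Type*) [Field K] [Algebra R K] [IsFractionRing R K]

/-- A nonzero integral ideal `I` with `I_t = I`. -/
def IsTIdeal (I : Ideal R) : Prop :=
  I ≠ ⊥ ∧ tClosure (I : FractionalIdeal R⁰ K) = (I : FractionalIdeal R⁰ K)

/-- A nonzero integral ideal `I` with `(I I⁻¹)_t = R`. -/
def IsTInvertible (I : Ideal R) : Prop :=
  I ≠ ⊥ ∧ tClosure ((I : FractionalIdeal R⁰ K) * (I : FractionalIdeal R⁰ K)⁻¹) = 1

/-- `I` and `J` are `t`-comaximal: `(I + J)_t = R`. -/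
def TComaximal (I J : Ideal R) : Prop :=
  tClosure ((I + J : Ideal R) : FractionalIdeal R⁰ K) = 1

/-- A packet: a `t`-invertible `t`-ideal `I ⊆ R` with a unique minimal prime. -/
def IsPacket (I : Ideal R) : Prop :=
  IsTIdeal K I ∧ IsTInvertible K I ∧ ∃! P : Ideal R, P ∈ I.minimalPrimes

/-- `s` is a factorization of `I` as the `t`-product of finitely many mutually `t`-comaximal
packets. -/
def IsPacketFactorization (I : Ideal R) (s : Multiset (Ideal R)) : Prop :=
  (∀ J ∈ s, IsPacket K J) ∧ s.Pairwise (TComaximal K) ∧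
    tClosure ((s.prod : Ideal R) : FractionalIdeal R⁰ K) = (I : FractionalIdeal R⁰ K)

/-- A `t`-maximal ideal: a maximal element of the set of proper integral `t`-ideals. -/
def IsTMaximal (M : Ideal R) : Prop :=
  Maximal (fun I : Ideal R => IsTIdeal K I ∧ I ≠ ⊤) M

variable (R)

/-- A unique representation domain: every proper `t`-invertible `t`-ideal is, uniquely up to the
order of the factors, a `t`-product of finitely many mutually `t`-comaximal packets. -/
def IsURD : Prop :=
  ∀ I : Ideal R, IsTIdeal K I → IsTInvertible K I → I ≠ ⊤ →
    ∃! s : Multiset (Ideal R), IsPacketFactorization K I s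

/-- A Prüfer `v`-multiplication domain: every nonzero finitely generated ideal is
`t`-invertible. -/
def IsPVMD : Prop :=
  ∀ I : Ideal R, I ≠ ⊥ → I.FG → IsTInvertible K I

/-- A ring of Krull type: a PVMD of `t`-finite character, i.e. one in which each nonzero element
lies in at most finitely many `t`-maximal ideals. -/
def IsKrullType : Prop :=
  IsPVMD R K ∧ ∀ x : R, x ≠ 0 → {M : Ideal R | IsTMaximal K M ∧ x ∈ M}.Finite

end TFactor

/-! A `t`-ideal is determined by its behaviour at the `t`-maximal ideals
(`mem_of_forall_isTMaximal`), and a `t`-invertible one is principal there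
(`isTInvertible_iff_forall`). In a PVMD the primes inside a `t`-maximal ideal form a chain, so such
an ideal contains at most one minimal prime of a given `I`. If the minimal primes of `I` are
finitely many, each of them carries a packet that agrees with `I` at the `t`-maximal ideals above it
(`exists_packet`), and the `t`-product of these packets is `I`. Uniqueness of the factorization
holds in every domain (`IsPacketFactorization.unique`).

Finiteness need only be known for principal ideals, because every minimal prime of a `t`-invertible
`t`-ideal is minimal over one of finitely many elements. Conversely, a prime minimal over a product
of packets is the minimal prime of a factor. In a ring of Krull type the minimal primes of `xR`
inject into the `t`-maximal ideals containing `x`. A GCD domain is a PVMD whose `t`-invertible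
`t`-ideals are principal, so there `t`-products are plain products. -/

namespace TFactor

/-! ### Closures of integral ideals in terms of divisibility -/

section Elementary

variable {R : Type*} [CommRing R]

/-- The `v`-closure of an integral ideal, described by divisibility in `R`. -/
def vIdeal (J : Ideal R) : Ideal R where
  carrier := {x | ∀ c d : R, (∀ a ∈ J, d ∣ c * a) → d ∣ c * x}
  zero_mem' := fun _ _ _ => by simp
  add_mem' := fun hx hy c d h => by
    rw [mul_add]
    exact dvd_add (hx c d h) (hy c d h)
  smul_mem' := fun r x hx c d h => by
    rw [smul_eq_mul, mul_left_comm]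
    exact (hx c d h).mul_left r

theorem le_vIdeal (J : Ideal R) : J ≤ vIdeal J := fun x hx _ _ h => h x hx

theorem vIdeal_le_vIdeal {I J : Ideal R} (h : I ≤ vIdeal J) : vIdeal I ≤ vIdeal J :=
  fun _ hx c d hd => hx c d fun _ ha => h ha c d hd

theorem vIdeal_mono {I J : Ideal R} (h : I ≤ J) : vIdeal I ≤ vIdeal J :=
  vIdeal_le_vIdeal (h.trans (le_vIdeal J))

theorem mul_mem_vIdeal {I J : Ideal R} {x y : R} (hx : x ∈ vIdeal I) (hy : y ∈ vIdeal J) :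
    x * y ∈ vIdeal (I * J) := by
  intro c d h
  rw [← mul_assoc]
  refine hy (c * x) d fun b hb => ?_
  rw [mul_right_comm]
  refine hx (c * b) d fun a ha => ?_
  have := h (a * b) (Ideal.mul_mem_mul ha hb)
  rwa [mul_assoc, mul_comm b a]

theorem pow_mem_vIdeal {I : Ideal R} {x : R} (hx : x ∈ vIdeal I) (n : ℕ) :
    x ^ n ∈ vIdeal (I ^ n) := by
  induction n with
  | zero => exact le_vIdeal _ (by simp)
  | succ n ih => rw [pow_succ, pow_succ]; exact mul_mem_vIdeal ih hx

theorem vIdeal_bot : vIdeal (⊥ : Ideal R) = ⊥ := by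
  rw [eq_bot_iff]
  intro x hx
  have := hx 1 0 (by simp)
  simpa using this

/-- The `t`-closure of an integral ideal, described by divisibility in `R`. -/
def tIdeal (A : Ideal R) : Ideal R where
  carrier := {x | ∃ J ≤ A, J.FG ∧ x ∈ vIdeal J}
  zero_mem' := ⟨⊥, bot_le, Submodule.fg_bot, zero_mem _⟩
  add_mem' := by
    rintro x y ⟨J, hJ, hJfg, hx⟩ ⟨L, hL, hLfg, hy⟩
    exact ⟨J ⊔ L, sup_le hJ hL, Submodule.FG.sup hJfg hLfg,
      add_mem (vIdeal_mono le_sup_left hx) (vIdeal_mono le_sup_right hy)⟩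
  smul_mem' := by
    rintro c x ⟨J, hJ, hJfg, hx⟩
    exact ⟨J, hJ, hJfg, Ideal.mul_mem_left _ c hx⟩

theorem le_tIdeal (A : Ideal R) : A ≤ tIdeal A := fun x hx =>
  ⟨Ideal.span {x}, by simpa [Ideal.span_le] using hx, Submodule.fg_span (Set.finite_singleton x),
    le_vIdeal _ (Ideal.mem_span_singleton_self x)⟩

theorem tIdeal_mono {A B : Ideal R} (h : A ≤ B) : tIdeal A ≤ tIdeal B :=
  fun _ ⟨J, hJ, hfg, hx⟩ => ⟨J, hJ.trans h, hfg, hx⟩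

theorem exists_fg_le_vIdeal {A J : Ideal R} (hfg : J.FG) (h : J ≤ tIdeal A) :
    ∃ L ≤ A, L.FG ∧ J ≤ vIdeal L := by
  induction J, hfg using Submodule.fg_induction with
  | singleton x =>
    obtain ⟨L, hL, hLfg, hx⟩ := h (Submodule.mem_span_singleton_self x)
    exact ⟨L, hL, hLfg, by rwa [Submodule.span_singleton_le_iff_mem]⟩
  | sup M₁ M₂ _ _ h₁ h₂ =>
    obtain ⟨L₁, hL₁, hf₁, hM₁⟩ := h₁ (le_sup_left.trans h)
    obtain ⟨L₂, hL₂, hf₂, hM₂⟩ := h₂ (le_sup_right.trans h)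
    exact ⟨L₁ ⊔ L₂, sup_le hL₁ hL₂, Submodule.FG.sup hf₁ hf₂,
      sup_le (hM₁.trans (vIdeal_mono le_sup_left)) (hM₂.trans (vIdeal_mono le_sup_right))⟩

theorem exists_fg_le_of_fg_le_sup {A B J : Ideal R} (hfg : J.FG) (h : J ≤ A ⊔ B) :
    ∃ A' ≤ A, ∃ B' ≤ B, A'.FG ∧ B'.FG ∧ J ≤ A' ⊔ B' := by
  induction J, hfg using Submodule.fg_induction with
  | singleton x =>
    obtain ⟨a, ha, b, hb, rfl⟩ := Submodule.mem_sup.1 (h (Submodule.mem_span_singleton_self x))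
    refine ⟨Ideal.span {a}, by simpa [Ideal.span_le] using ha, Ideal.span {b},
      by simpa [Ideal.span_le] using hb, Submodule.fg_span (Set.finite_singleton a),
      Submodule.fg_span (Set.finite_singleton b), ?_⟩
    rw [Submodule.span_singleton_le_iff_mem]
    exact Submodule.add_mem_sup (Ideal.mem_span_singleton_self a) (Ideal.mem_span_singleton_self b)
  | sup M₁ M₂ _ _ h₁ h₂ =>
    obtain ⟨A₁, hA₁, B₁, hB₁, fA₁, fB₁, h₁⟩ := h₁ (le_sup_left.trans h)
    obtain ⟨A₂, hA₂, B₂, hB₂, fA₂, fB₂, h₂⟩ := h₂ (le_sup_right.trans h)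
    refine ⟨A₁ ⊔ A₂, sup_le hA₁ hA₂, B₁ ⊔ B₂, sup_le hB₁ hB₂, Submodule.FG.sup fA₁ fA₂,
      Submodule.FG.sup fB₁ fB₂, ?_⟩
    rw [sup_sup_sup_comm]
    exact sup_le_sup h₁ h₂

theorem tIdeal_tIdeal_le (A : Ideal R) : tIdeal (tIdeal A) ≤ tIdeal A := by
  rintro x ⟨J, hJ, hfg, hx⟩
  obtain ⟨L, hL, hLfg, hJL⟩ := exists_fg_le_vIdeal hfg hJ
  exact ⟨L, hL, hLfg, vIdeal_le_vIdeal hJL hx⟩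

theorem tIdeal_le {A I : Ideal R} (h : A ≤ I) (hI : tIdeal I ≤ I) : tIdeal A ≤ I :=
  (tIdeal_mono h).trans hI

/-- Used mostly with `x = 1`, or with `A` a power: multiplying a `t`-closure into a `t`-closed ideal
needs checking only before closing. -/
theorem mul_mem_of_mem_tIdeal {A I : Ideal R} {b x : R} (hI : tIdeal I ≤ I)
    (h : ∀ y ∈ A, b * y ∈ I) (hx : x ∈ tIdeal A) : b * x ∈ I := by
  obtain ⟨J, hJ, hfg, hx⟩ := hx
  refine hI ⟨Ideal.span {b} * J, ?_, (Submodule.fg_span (Set.finite_singleton b)).mul hfg,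
    mul_mem_vIdeal (le_vIdeal _ (Ideal.mem_span_singleton_self b)) hx⟩
  rw [Ideal.span_singleton_mul_le_iff]
  exact fun y hy => h y (hJ hy)

theorem tIdeal_span_singleton_le (x : R) :
    tIdeal (Ideal.span {x}) ≤ Ideal.span {x} := by
  rintro y ⟨J, hJ, -, hy⟩
  rw [Ideal.mem_span_singleton]
  simpa using hy 1 x fun a ha => by simpa using Ideal.mem_span_singleton.1 (hJ ha)

/-- Otherwise `I` misses the multiplicative set generated by `x` and the complement of `P`; a prime
over `I` disjoint from that set lies in `P` and omits `x`, against minimality. -/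
theorem exists_mul_pow_mem_of_mem_minimalPrimes {I P : Ideal R} (hP : P ∈ I.minimalPrimes) {x : R}
    (hx : x ∈ P) : ∃ s ∉ P, ∃ n : ℕ, s * x ^ n ∈ I := by
  have hPp : P.IsPrime := hP.1.1
  by_contra! h
  obtain ⟨Q, hQp, hIQ, hQ⟩ := Ideal.exists_le_prime_disjoint I (P.primeCompl ⊔ Submonoid.powers x)
    (by
      rw [Set.disjoint_left]
      intro y hyI hy
      obtain ⟨s, hs, z, ⟨n, rfl⟩, rfl⟩ := Submonoid.mem_sup.1 hy
      exact h s hs n hyI)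
  rw [Set.disjoint_left] at hQ
  have hQP : Q ≤ P := fun y hy => by
    by_contra hyP
    exact hQ hy (SetLike.le_def.1 (le_sup_left : P.primeCompl ≤ _) hyP)
  exact hQ (hP.2 ⟨hQp, hIQ⟩ hQP hx)
    (SetLike.le_def.1 (le_sup_right : Submonoid.powers x ≤ _) (Submonoid.mem_powers x))

theorem exists_mul_pow_le_of_mem_minimalPrimes {I P J : Ideal R} (hP : P ∈ I.minimalPrimes)
    (hfg : J.FG) (hJ : J ≤ P) : ∃ s ∉ P, ∃ n : ℕ, ∀ y ∈ J ^ n, s * y ∈ I := by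
  have hPp : P.IsPrime := hP.1.1
  induction J, hfg using Submodule.fg_induction with
  | singleton a =>
    obtain ⟨s, hs, n, hn⟩ := exists_mul_pow_mem_of_mem_minimalPrimes hP
      (hJ (Submodule.mem_span_singleton_self a))
    refine ⟨s, hs, n, fun y hy => ?_⟩
    rw [Ideal.submodule_span_eq, Ideal.span_singleton_pow, Ideal.mem_span_singleton] at hy
    obtain ⟨r, rfl⟩ := hy
    rw [← mul_assoc]
    exact Ideal.mul_mem_right _ _ hn
  | sup M₁ M₂ _ _ h₁ h₂ =>
    obtain ⟨s₁, hs₁, n₁, h₁⟩ := h₁ (le_sup_left.trans hJ)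
    obtain ⟨s₂, hs₂, n₂, h₂⟩ := h₂ (le_sup_right.trans hJ)
    refine ⟨s₁ * s₂, fun h => (hPp.mem_or_mem h).elim hs₁ hs₂, n₁ + n₂, fun y hy => ?_⟩
    obtain ⟨u, hu, v, hv, rfl⟩ := Submodule.mem_sup.1 (Ideal.sup_pow_add_le_pow_sup_pow hy)
    rw [mul_add, mul_right_comm, mul_assoc s₁ s₂ v]
    exact add_mem (Ideal.mul_mem_right _ _ (h₁ u hu)) (Ideal.mul_mem_left _ _ (h₂ v hv))

/-- A prime minimal over a `t`-closed ideal is `t`-closed. -/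
theorem tIdeal_le_of_mem_minimalPrimes {I P : Ideal R} (hI : tIdeal I ≤ I)
    (hP : P ∈ I.minimalPrimes) : tIdeal P ≤ P := by
  have hPp : P.IsPrime := hP.1.1
  rintro x ⟨J, hJ, hfg, hx⟩
  -- From `s J ^ n ⊆ I` closure gives `s * x ^ n ∈ I ≤ P`, and `s ∉ P`.
  obtain ⟨s, hs, n, hn⟩ := exists_mul_pow_le_of_mem_minimalPrimes hP hfg hJ
  have h1 : x ^ n ∈ tIdeal (J ^ n) := ⟨J ^ n, le_rfl, Ideal.FG.pow hfg, pow_mem_vIdeal hx n⟩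
  have h2 := hP.1.2 (mul_mem_of_mem_tIdeal hI hn h1)
  exact hPp.mem_of_pow_mem n ((hPp.mem_or_mem h2).resolve_left hs)

theorem not_le_of_tIdeal_eq_top {A P : Ideal R} (h : tIdeal A = ⊤) (hP : tIdeal P ≤ P)
    (hP1 : P ≠ ⊤) : ¬ A ≤ P := fun hle =>
  hP1 (top_le_iff.1 (h ▸ tIdeal_le hle hP))

/-- The ideal generated by the multipliers `s` carrying `I` into a principal ideal generated by a
nonzero element of `I`. -/
def multiplierIdeal (I : Ideal R) : Ideal R :=
  Ideal.span {s | ∃ a ∈ I, a ≠ 0 ∧ ∀ x ∈ I, a ∣ s * x}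

theorem multiplierIdeal_ne_bot {I : Ideal R} (hI : I ≠ ⊥) : multiplierIdeal I ≠ ⊥ := by
  obtain ⟨a, ha, ha0⟩ := Submodule.exists_mem_ne_zero_of_ne_bot hI
  intro h
  have : a ∈ multiplierIdeal I := Ideal.subset_span ⟨a, ha, ha0, fun x _ => dvd_mul_right a x⟩
  rw [h] at this
  exact ha0 this

/-- A greatest common divisor of a finite set lies in the `v`-closure of the ideal it generates. -/
theorem exists_gcd_mem_vIdeal [IsGCDMonoid R] (F : Finset R) :
    ∃ g : R, (∀ a ∈ F, g ∣ a) ∧ ∀ c d : R, (∀ a ∈ F, d ∣ c * a) → d ∣ c * g := by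
  classical
  obtain ⟨_⟩ := ‹IsGCDMonoid R›
  induction F using Finset.induction_on with
  | empty => exact ⟨0, by simp, by simp⟩
  | insert a F _ ih =>
    obtain ⟨g, hg, hg'⟩ := ih
    refine ⟨gcd a g, ?_, fun c d h => ?_⟩
    · intro b hb
      rcases Finset.mem_insert.1 hb with rfl | hb
      · exact gcd_dvd_left _ _
      · exact (gcd_dvd_right _ _).trans (hg b hb)
    · exact (dvd_gcd (h a (Finset.mem_insert_self _ _))
        (hg' c d fun b hb => h b (Finset.mem_insert_of_mem hb))).trans (gcd_mul_left' c a g).dvd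

end Elementary

/-! ### Translation from fractional ideals to divisibility -/

section Bridge

variable {R : Type*} [CommRing R]
variable (K : Type*) [Field K] [Algebra R K] [IsFractionRing R K]

theorem div_mul_mem_one_iff {c d a : R} (hd : d ≠ 0) :
    algebraMap R K c / algebraMap R K d * algebraMap R K a ∈ (1 : FractionalIdeal R⁰ K) ↔
      d ∣ c * a := by
  have hd' : algebraMap R K d ≠ 0 := by
    rwa [Ne, IsFractionRing.to_map_eq_zero_iff]
  rw [FractionalIdeal.mem_one_iff]
  constructor
  · rintro ⟨r, hr⟩
    refine ⟨r, IsFractionRing.injective R K ?_⟩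
    rw [map_mul, map_mul, hr]
    field_simp
  · rintro ⟨r, hr⟩
    refine ⟨r, ?_⟩
    have := congrArg (algebraMap R K) hr
    rw [map_mul, map_mul] at this
    field_simp
    rw [this, mul_comm]

variable [IsDomain R]

theorem div_mem_inv_iff {J : Ideal R} (hJ : J ≠ ⊥) {c d : R} (hd : d ≠ 0) :
    algebraMap R K c / algebraMap R K d ∈ (J : FractionalIdeal R⁰ K)⁻¹ ↔
      ∀ a ∈ J, d ∣ c * a := by
  rw [FractionalIdeal.mem_inv_iff (by rwa [Ne, FractionalIdeal.coeIdeal_eq_zero])]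
  constructor
  · intro h a ha
    exact (div_mul_mem_one_iff K hd).1 (h _ (FractionalIdeal.mem_coeIdeal_of_mem R⁰ ha))
  · rintro h y hy
    obtain ⟨a, ha, rfl⟩ := (FractionalIdeal.mem_coeIdeal R⁰).1 hy
    exact (div_mul_mem_one_iff K hd).2 (h a ha)

theorem one_mem_coeIdeal_inv {J : Ideal R} (hJ : J ≠ ⊥) :
    (1 : K) ∈ (J : FractionalIdeal R⁰ K)⁻¹ := by
  have := (div_mem_inv_iff K hJ (c := 1) one_ne_zero).2 fun a _ => one_dvd _
  simpa using this

theorem mem_vClosure_coeIdeal {J : Ideal R} (hJ : J ≠ ⊥) {x : K} :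
    x ∈ vClosure (J : FractionalIdeal R⁰ K) ↔ ∃ r ∈ vIdeal J, algebraMap R K r = x := by
  have h0 : (J : FractionalIdeal R⁰ K)⁻¹ ≠ 0 := by
    intro h
    have := one_mem_coeIdeal_inv K hJ
    rw [h, FractionalIdeal.mem_zero_iff] at this
    exact one_ne_zero this
  unfold vClosure
  rw [FractionalIdeal.mem_inv_iff h0]
  constructor
  · intro h
    obtain ⟨r, rfl⟩ := (FractionalIdeal.mem_one_iff R⁰).1 (by
      simpa using h 1 (one_mem_coeIdeal_inv K hJ))
    refine ⟨r, fun c d hcd => ?_, rfl⟩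
    -- `vIdeal` also allows `d = 0`, which is no fraction; a nonzero element of `J` then forces `c =
    -- 0`.
    by_cases hd : d = 0
    · subst hd
      obtain ⟨a, ha, ha0⟩ := Submodule.exists_mem_ne_zero_of_ne_bot hJ
      have := zero_dvd_iff.1 (hcd a ha)
      simp [(mul_eq_zero.1 this).resolve_right ha0]
    · rw [← div_mul_mem_one_iff K hd, mul_comm]
      exact h _ ((div_mem_inv_iff K hJ hd).2 hcd)
  · rintro ⟨r, hr, rfl⟩ y hy
    obtain ⟨c, d, hd, rfl⟩ := IsFractionRing.div_surjective R y
    have hd0 := nonZeroDivisors.ne_zero hd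
    rw [mul_comm, div_mul_mem_one_iff K hd0]
    exact hr c d ((div_mem_inv_iff K hJ hd0).1 hy)

theorem tClosure_coeIdeal (A : Ideal R) :
    tClosure (A : FractionalIdeal R⁰ K) = (tIdeal A : Ideal R) := by
  ext x
  rw [mem_tClosure, FractionalIdeal.mem_coeIdeal]
  constructor
  · rintro ⟨J, hJ, hfg, hx⟩
    obtain ⟨L, rfl⟩ := FractionalIdeal.le_one_iff_exists_coeIdeal.1
      (hJ.trans FractionalIdeal.coeIdeal_le_one)
    rw [FractionalIdeal.coeIdeal_le_coeIdeal] at hJ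
    rw [FractionalIdeal.coeIdeal_fg _ (IsFractionRing.injective R K)] at hfg
    by_cases hL : L = ⊥
    · subst hL
      have : x = 0 := by
        simpa [vClosure, FractionalIdeal.inv_zero'] using hx
      exact ⟨0, zero_mem _, by simp [this]⟩
    · obtain ⟨r, hr, rfl⟩ := (mem_vClosure_coeIdeal K hL).1 hx
      exact ⟨r, ⟨L, hJ, hfg, hr⟩, rfl⟩
  · rintro ⟨r, ⟨J, hJ, hfg, hr⟩, rfl⟩
    refine ⟨J, (FractionalIdeal.coeIdeal_le_coeIdeal K).2 hJ,
      (FractionalIdeal.coeIdeal_fg _ (IsFractionRing.injective R K) _).2 hfg, ?_⟩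
    by_cases hL : J = ⊥
    · subst hL
      rw [vIdeal_bot] at hr
      rw [(Submodule.mem_bot R).1 hr, map_zero]
      exact Submodule.zero_mem _
    · exact (mem_vClosure_coeIdeal K hL).2 ⟨r, hr, rfl⟩

theorem isTIdeal_iff {I : Ideal R} : IsTIdeal K I ↔ I ≠ ⊥ ∧ tIdeal I ≤ I := by
  unfold IsTIdeal
  rw [tClosure_coeIdeal, FractionalIdeal.coeIdeal_inj]
  exact and_congr_right fun _ => ⟨fun h => h.le, fun h => le_antisymm h (le_tIdeal I)⟩

theorem tComaximal_iff {I J : Ideal R} : TComaximal K I J ↔ tIdeal (I ⊔ J) = ⊤ := by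
  unfold TComaximal
  rw [tClosure_coeIdeal, FractionalIdeal.coeIdeal_eq_one,
    Ideal.one_eq_top, Submodule.add_eq_sup]

/-- A product `s = a * (c / d)` with `a ≠ 0` has `s / a = c / d` in the inverse of `I`, so the
denominator can always be taken to be `a` itself. -/
theorem coeIdeal_mul_inv {I : Ideal R} (hI : I ≠ ⊥) :
    (I : FractionalIdeal R⁰ K) * (I : FractionalIdeal R⁰ K)⁻¹ = multiplierIdeal I := by
  apply le_antisymm
  · rw [FractionalIdeal.mul_le]
    rintro i hi j hj
    obtain ⟨a, ha, rfl⟩ := (FractionalIdeal.mem_coeIdeal R⁰).1 hi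
    obtain ⟨c, d, hd, rfl⟩ := IsFractionRing.div_surjective R j
    have hd0 := nonZeroDivisors.ne_zero hd
    rw [div_mem_inv_iff K hI hd0] at hj
    by_cases ha0 : a = 0
    · simp [ha0]
    obtain ⟨s, hs⟩ := hj a ha
    rw [FractionalIdeal.mem_coeIdeal]
    refine ⟨s, Ideal.subset_span ⟨a, ha, ha0, fun x hx => ?_⟩, ?_⟩
    · obtain ⟨r, hr⟩ := hj x hx
      refine ⟨r, mul_left_cancel₀ hd0 ?_⟩
      rw [← mul_assoc, ← hs, mul_left_comm, ← hr]
      ring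
    · have hd' : algebraMap R K d ≠ 0 := by
        rwa [Ne, IsFractionRing.to_map_eq_zero_iff]
      have := congrArg (algebraMap R K) hs
      rw [map_mul, map_mul] at this
      field_simp
      rw [mul_comm, ← this, mul_comm]
  · rintro x hx
    obtain ⟨r, hr, rfl⟩ := (FractionalIdeal.mem_coeIdeal R⁰).1 hx
    refine Submodule.span_induction ?_ ?_ ?_ ?_ hr
    · rintro s ⟨a, ha, ha0, h⟩
      have ha' : algebraMap R K a ≠ 0 := by
        rwa [Ne, IsFractionRing.to_map_eq_zero_iff]
      have := FractionalIdeal.mul_mem_mul (FractionalIdeal.mem_coeIdeal_of_mem R⁰ ha)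
        ((div_mem_inv_iff K hI ha0).2 h)
      rwa [mul_div_cancel₀ _ ha'] at this
    · rw [map_zero]; exact Submodule.zero_mem _
    · intro x y _ _ hx hy
      rw [map_add]; exact Submodule.add_mem _ hx hy
    · intro c x _ hx
      rw [smul_eq_mul, map_mul, ← Algebra.smul_def]
      exact Submodule.smul_mem _ c hx

theorem isTInvertible_iff {I : Ideal R} :
    IsTInvertible K I ↔ I ≠ ⊥ ∧ tIdeal (multiplierIdeal I) = ⊤ := by
  unfold IsTInvertible
  refine and_congr_right fun hI => ?_
  rw [coeIdeal_mul_inv K hI, tClosure_coeIdeal, FractionalIdeal.coeIdeal_eq_one, Ideal.one_eq_top]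

theorem isPacketFactorization_iff {I : Ideal R} {s : Multiset (Ideal R)} :
    IsPacketFactorization K I s ↔
      (∀ J ∈ s, IsPacket K J) ∧ s.Pairwise (TComaximal K) ∧ tIdeal s.prod = I := by
  unfold IsPacketFactorization
  rw [tClosure_coeIdeal, FractionalIdeal.coeIdeal_inj]

end Bridge

/-! ### `t`-maximal ideals and local tests -/

section TMaximal

variable {R : Type*} [CommRing R] [IsDomain R]
variable (K : Type*) [Field K] [Algebra R K] [IsFractionRing R K]

/-- Zorn applies because `t` has finite type: a finitely generated ideal inside the union of a chain
lies in one member. -/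
theorem exists_isTMaximal_ge {A : Ideal R} (hA : A ≠ ⊥) (h : tIdeal A ≠ ⊤) :
    ∃ M, IsTMaximal K M ∧ A ≤ M := by
  have hA' : IsTIdeal K (tIdeal A) :=
    (isTIdeal_iff K).2 ⟨fun h0 => hA (eq_bot_iff.2 (h0 ▸ le_tIdeal A)), tIdeal_tIdeal_le A⟩
  obtain ⟨M, hAM, hM⟩ := zorn_le_nonempty₀ {I : Ideal R | IsTIdeal K I ∧ I ≠ ⊤} (by
    intro c hc hchain I hI
    have hdir : DirectedOn (· ≤ ·) c := hchain.directedOn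
    refine ⟨sSup c, ⟨(isTIdeal_iff K).2 ⟨?_, ?_⟩, ?_⟩, fun J hJ => le_sSup hJ⟩
    · intro h0
      exact ((isTIdeal_iff K).1 (hc hI).1).1 (eq_bot_iff.2 (h0 ▸ le_sSup hI))
    · rintro x ⟨J, hJ, hfg, hx⟩
      obtain ⟨L, hL, hJL⟩ := (CompleteLattice.isCompactElement_iff_le_of_directed_sSup_le _ _).1
        ((Submodule.fg_iff_compact J).1 hfg) c ⟨I, hI⟩ hdir hJ
      exact le_sSup hL (((isTIdeal_iff K).1 (hc hL).1).2 ⟨J, hJL, hfg, hx⟩)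
    · intro htop
      obtain ⟨L, hL, h1⟩ := (Submodule.mem_sSup_of_directed ⟨I, hI⟩ hdir).1
        ((Ideal.eq_top_iff_one _).1 htop)
      exact (hc hL).2 ((Ideal.eq_top_iff_one _).2 h1)) (tIdeal A) ⟨hA', h⟩
  exact ⟨M, hM, (le_tIdeal A).trans hAM⟩

variable {K} in
theorem IsTMaximal.tIdeal_le {M : Ideal R} (hM : IsTMaximal K M) : tIdeal M ≤ M :=
  ((isTIdeal_iff K).1 hM.1.1).2

variable {K} in
theorem IsTMaximal.ne_bot {M : Ideal R} (hM : IsTMaximal K M) : M ≠ ⊥ :=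
  ((isTIdeal_iff K).1 hM.1.1).1

variable {K} in
theorem IsTMaximal.isPrime {M : Ideal R} (hM : IsTMaximal K M) : M.IsPrime := by
  refine ⟨hM.1.2, fun {x y} hxy => ?_⟩
  by_contra! h
  have hA : M ⊔ Ideal.span {x} ≠ ⊥ := fun h0 => hM.ne_bot (eq_bot_iff.2 (h0 ▸ le_sup_left))
  by_cases ht : tIdeal (M ⊔ Ideal.span {x}) = ⊤
  · refine h.2 ?_
    have h1 : (1 : R) ∈ tIdeal (M ⊔ Ideal.span {x}) := ht ▸ Submodule.mem_top
    rw [← mul_one y]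
    refine mul_mem_of_mem_tIdeal hM.tIdeal_le (fun z hz => ?_) h1
    obtain ⟨m, hm, w, hw, rfl⟩ := Submodule.mem_sup.1 hz
    obtain ⟨r, rfl⟩ := Ideal.mem_span_singleton.1 hw
    rw [mul_add, ← mul_assoc, mul_comm y x]
    exact add_mem (Ideal.mul_mem_left _ _ hm) (Ideal.mul_mem_right _ _ hxy)
  · obtain ⟨N, hN, hle⟩ := exists_isTMaximal_ge K hA ht
    have := hM.2 hN.1 (le_sup_left.trans hle)
    exact h.1 (this (hle (Ideal.mem_sup_right (Ideal.mem_span_singleton_self x))))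

theorem tIdeal_eq_top_of_forall {A : Ideal R} (hA : A ≠ ⊥) (h : ∀ M, IsTMaximal K M → ¬ A ≤ M) :
    tIdeal A = ⊤ := by
  by_contra ht
  obtain ⟨M, hM, hAM⟩ := exists_isTMaximal_ge K hA ht
  exact h M hM hAM

/-- Membership in a `t`-ideal can be checked at the `t`-maximal ideals. -/
theorem mem_of_forall_isTMaximal {I : Ideal R} (hI0 : I ≠ ⊥) (hI : tIdeal I ≤ I) {x : R}
    (h : ∀ M, IsTMaximal K M → ∃ s ∉ M, s * x ∈ I) : x ∈ I := by
  -- The comap is the colon ideal `(I : x)`; it lies in no `t`-maximal ideal, so its `t`-closure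
  -- contains 1.
  have hle : I ≤ Submodule.comap (LinearMap.toSpanSingleton R R x) I := fun y hy => by
    simpa using Ideal.mul_mem_right x I hy
  have htop : tIdeal (Submodule.comap (LinearMap.toSpanSingleton R R x) I : Ideal R) = ⊤ := by
    refine tIdeal_eq_top_of_forall K (fun h0 => hI0 (eq_bot_iff.2 (h0 ▸ hle))) fun M hM hCM => ?_
    obtain ⟨s, hs, hsx⟩ := h M hM
    exact hs (hCM (by simpa using hsx))
  have h1 : (1 : R) ∈ tIdeal (Submodule.comap (LinearMap.toSpanSingleton R R x) I : Ideal R) :=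
    htop ▸ Submodule.mem_top
  rw [← mul_one x]
  refine mul_mem_of_mem_tIdeal hI (fun y hy => ?_) h1
  rw [mul_comm]
  simpa using hy

/-- An ideal is `t`-invertible iff it is principal locally at each `t`-maximal ideal, in a sense
that includes a common denominator. -/
theorem isTInvertible_iff_forall {I : Ideal R} (hI : I ≠ ⊥) : IsTInvertible K I ↔
    ∀ M, IsTMaximal K M → ∃ a ∈ I, a ≠ 0 ∧ ∃ s ∉ M, ∀ x ∈ I, a ∣ s * x := by
  rw [isTInvertible_iff]
  constructor
  · rintro ⟨-, h⟩ M hM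
    have := not_le_of_tIdeal_eq_top h hM.tIdeal_le hM.1.2
    rw [multiplierIdeal, Ideal.span_le, Set.not_subset] at this
    obtain ⟨s, ⟨a, ha, ha0, hs⟩, hsM⟩ := this
    exact ⟨a, ha, ha0, s, hsM, hs⟩
  · intro h
    refine ⟨hI, tIdeal_eq_top_of_forall K (multiplierIdeal_ne_bot hI) fun M hM hle => ?_⟩
    obtain ⟨a, ha, ha0, s, hsM, hs⟩ := h M hM
    exact hsM (hle (Ideal.subset_span ⟨a, ha, ha0, hs⟩))

theorem isTInvertible_span_singleton {x : R} (hx : x ≠ 0) :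
    IsTInvertible K (Ideal.span {x}) := by
  rw [isTInvertible_iff_forall K (by simpa using hx)]
  intro M hM
  refine ⟨x, Ideal.mem_span_singleton_self x, hx, 1, (Ideal.ne_top_iff_one M).1 hM.1.2, ?_⟩
  intro y hy
  rw [one_mul]
  exact Ideal.mem_span_singleton.1 hy

theorem isTIdeal_span_singleton {x : R} (hx : x ≠ 0) : IsTIdeal K (Ideal.span {x}) :=
  (isTIdeal_iff K).2 ⟨by simpa using hx, tIdeal_span_singleton_le x⟩

variable {K} in
/-- A `t`-invertible ideal is locally generated by the members of a finite set. -/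
theorem IsTInvertible.exists_finset {I : Ideal R} (hI : IsTInvertible K I) :
    ∃ F : Finset R, (∀ a ∈ F, a ∈ I ∧ a ≠ 0) ∧ ∀ P : Ideal R, tIdeal P ≤ P → P ≠ ⊤ →
      ∃ a ∈ F, ∃ s ∉ P, ∀ x ∈ I, a ∣ s * x := by
  classical
  obtain ⟨-, h⟩ := (isTInvertible_iff K).1 hI
  obtain ⟨J, hJ, ⟨G, hG⟩, h1⟩ : (1 : R) ∈ tIdeal (multiplierIdeal I) := h ▸ Submodule.mem_top
  have hGm : (G : Set R) ⊆ Ideal.span {s | ∃ a ∈ I, a ≠ 0 ∧ ∀ x ∈ I, a ∣ s * x} := by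
    rw [← Ideal.submodule_span_eq, ← Submodule.span_le]
    exact hG.trans_le hJ
  obtain ⟨T, hTs, hGT⟩ := Submodule.subset_span_finite_of_subset_span hGm
  have hTm : ∀ s ∈ T, ∃ a ∈ I, a ≠ 0 ∧ ∀ x ∈ I, a ∣ s * x := fun s hs => hTs hs
  choose! f hfI hf0 hf using hTm
  refine ⟨T.image f, fun a ha => ?_, fun P hP hP1 => ?_⟩
  · obtain ⟨s, hs, rfl⟩ := Finset.mem_image.1 ha
    exact ⟨hfI s hs, hf0 s hs⟩
  -- `F` comes from one expression of 1 and so serves every `P`: if all multipliers in `T` were in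
  -- `P`, then `J ≤ P` and 1 would be in `P`.
  · by_contra! hcon
    have hTP : (T : Set R) ⊆ P := fun s hs => by
      by_contra hsP
      obtain ⟨x, hx, hndvd⟩ := hcon (f s) (Finset.mem_image_of_mem f hs) s hsP
      exact hndvd (hf s hs x hx)
    have hJP : J ≤ P := by
      rw [← hG]
      exact Submodule.span_le.2 (hGT.trans (Submodule.span_le.2 hTP))
    exact hP1 ((Ideal.eq_top_iff_one P).2 (hP ⟨J, hJP, ⟨G, hG⟩, h1⟩))

/-- A minimal prime `P` of `I` is `t`-closed, so near `P` the ideal `I` is generated by some `a ∈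
F`, and `P` is minimal over `a`. -/
theorem minimalPrimes_subset_of_isTInvertible {I : Ideal R} (hIt : IsTIdeal K I)
    (hI : IsTInvertible K I) :
    ∃ F : Finset R, (∀ a ∈ F, a ≠ 0) ∧
      I.minimalPrimes ⊆ ⋃ a ∈ F, (Ideal.span {a} : Ideal R).minimalPrimes := by
  obtain ⟨F, hF, h⟩ := hI.exists_finset
  refine ⟨F, fun a ha => (hF a ha).2, fun P hP => ?_⟩
  have hPp : P.IsPrime := hP.1.1
  obtain ⟨a, ha, s, hs, hdvd⟩ := h P
    (tIdeal_le_of_mem_minimalPrimes ((isTIdeal_iff K).1 hIt).2 hP) hPp.ne_top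
  refine Set.mem_biUnion ha ⟨⟨hPp, ?_⟩, fun Q hQ hQP => hP.2 ⟨hQ.1, fun x hx => ?_⟩ hQP⟩
  · rw [Ideal.span_singleton_le_iff_mem]
    exact hP.1.2 (hF a ha).1
  · have haQ : a ∈ Q := by rw [← Ideal.span_singleton_le_iff_mem]; exact hQ.2
    exact (hQ.1.mem_or_mem (Ideal.mem_of_dvd _ (hdvd x hx) haQ)).resolve_left fun h => hs (hQP h)

/-- In a PVMD the primes inside a proper `t`-closed prime form a chain. -/
theorem IsPVMD.le_total (hR : IsPVMD R K) {M P Q : Ideal R} [hM : M.IsPrime] (hMt : tIdeal M ≤ M)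
    [hP : P.IsPrime] [hQ : Q.IsPrime] (hPM : P ≤ M) (hQM : Q ≤ M) : P ≤ Q ∨ Q ≤ P := by
  by_contra! h
  obtain ⟨a, haP, haQ⟩ := SetLike.not_le_iff_exists.1 h.1
  obtain ⟨b, hbQ, hbP⟩ := SetLike.not_le_iff_exists.1 h.2
  have hne : (Ideal.span {a, b} : Ideal R) ≠ ⊥ := by
    intro h0
    have : a ∈ (Ideal.span {a, b} : Ideal R) := Ideal.subset_span (by simp)
    rw [h0, Submodule.mem_bot] at this
    exact haQ (this ▸ zero_mem Q)
  have hinv := (isTInvertible_iff K).1 (hR _ hne (Submodule.fg_span (Set.toFinite _)))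
  have := not_le_of_tIdeal_eq_top hinv.2 hMt hM.ne_top
  rw [multiplierIdeal, Ideal.span_le, Set.not_subset] at this
  obtain ⟨s, ⟨c, hc, hc0, hs⟩, hsM⟩ := this
  obtain ⟨u, hu⟩ := hs a (Ideal.subset_span (by simp))
  obtain ⟨v, hv⟩ := hs b (Ideal.subset_span (by simp))
  obtain ⟨p, q, hpq⟩ := Ideal.mem_span_pair.1 hc
  -- Here `c = p * a + q * b`, `s * a = c * u` and `s * b = c * v`. The aim is `u ∈ P` and `v ∈ Q`,
  -- which puts `s` in `M`.
  have hs' : s = p * u + q * v := by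
    apply mul_left_cancel₀ hc0
    linear_combination p * hu + q * hv - s * hpq
  have huv : u * b = v * a := by
    apply mul_left_cancel₀ hc0
    linear_combination a * hv - b * hu
  have huP : u ∈ P := (hP.mem_or_mem (huv ▸ Ideal.mul_mem_left P v haP)).resolve_right hbP
  have hvQ : v ∈ Q := (hQ.mem_or_mem (huv ▸ Ideal.mul_mem_left Q u hbQ)).resolve_right haQ
  exact hsM (hs' ▸ add_mem (Ideal.mul_mem_left _ _ (hPM huP)) (Ideal.mul_mem_left _ _ (hQM hvQ)))

theorem IsPVMD.eq_of_mem_minimalPrimes (hR : IsPVMD R K) {I M P Q : Ideal R} [M.IsPrime]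
    (hMt : tIdeal M ≤ M) (hP : P ∈ I.minimalPrimes) (hQ : Q ∈ I.minimalPrimes)
    (hPM : P ≤ M) (hQM : Q ≤ M) : P = Q := by
  have := hP.1.1
  have := hQ.1.1
  rcases hR.le_total K hMt hPM hQM with h | h
  · exact le_antisymm h (hQ.2 hP.1 h)
  · exact le_antisymm (hP.2 hQ.1 h) h

end TMaximal

/-! ### Existence and uniqueness of packet factorizations -/

section Factorization

variable {R : Type*} [CommRing R] [IsDomain R]
variable {K : Type*} [Field K] [Algebra R K] [IsFractionRing R K]

theorem IsPacket.tIdeal_le {X : Ideal R} (hX : IsPacket K X) : tIdeal X ≤ X :=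
  ((isTIdeal_iff K).1 hX.1).2

theorem IsPacket.ne_bot {X : Ideal R} (hX : IsPacket K X) : X ≠ ⊥ :=
  ((isTIdeal_iff K).1 hX.1).1

theorem IsPacket.ne_top {X : Ideal R} (hX : IsPacket K X) : X ≠ ⊤ := by
  rintro rfl
  obtain ⟨P, hP, -⟩ := hX.2.2
  simp [Ideal.minimalPrimes_top] at hP

theorem IsPacket.le_of_mem_minimalPrimes {X P Q : Ideal R} (hX : IsPacket K X)
    (hP : P ∈ X.minimalPrimes) (hQ : Q.IsPrime) (hXQ : X ≤ Q) : P ≤ Q := by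
  obtain ⟨P', hP', hle⟩ := Ideal.exists_minimalPrimes_le hXQ
  rwa [hX.2.2.unique hP hP']

/-- The packet of `I` belonging to the minimal prime `P`, when no two minimal primes of `I` lie in
the same `t`-maximal ideal. -/
theorem exists_packet {I P : Ideal R} (hIt : IsTIdeal K I) (hI : IsTInvertible K I)
    (hfin : I.minimalPrimes.Finite)
    (hsep : ∀ M, IsTMaximal K M → ∀ P ∈ I.minimalPrimes, ∀ Q ∈ I.minimalPrimes,
      P ≤ M → Q ≤ M → P = Q)
    (hP : P ∈ I.minimalPrimes) :
    ∃ X, IsPacket K X ∧ X.minimalPrimes = {P} ∧ I ≤ X ∧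
      ∀ M, IsTMaximal K M → P ≤ M → ∃ b ∉ M, ∀ x ∈ X, b * x ∈ I := by
  classical
  obtain ⟨hI0, hIcl⟩ := (isTIdeal_iff K).1 hIt
  have hPp : P.IsPrime := hP.1.1
  have hP0 : P ≠ ⊥ := fun h0 => hI0 (eq_bot_iff.2 (h0 ▸ hP.1.2))
  set C : Ideal R := (hfin.toFinset.erase P).inf id with hC
  have hCle : ∀ Q ∈ I.minimalPrimes, Q ≠ P → C ≤ Q := fun Q hQ hne =>
    Finset.inf_le (f := id) (Finset.mem_erase.2 ⟨hne, hfin.mem_toFinset.2 hQ⟩)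
  have htop : tIdeal (P ⊔ C) = ⊤ := by
    refine tIdeal_eq_top_of_forall K (fun h0 => hP0 (eq_bot_iff.2 (h0 ▸ le_sup_left)))
      fun M hM hle => ?_
    obtain ⟨Q, hQ, hQM⟩ := hM.isPrime.inf_le'.1 (le_sup_right.trans hle)
    obtain ⟨hne, hQ⟩ := Finset.mem_erase.1 hQ
    exact hne (hsep M hM Q (hfin.mem_toFinset.1 hQ) P hP hQM (le_sup_left.trans hle))
  obtain ⟨J, hJ, hJfg, hJ1⟩ : (1 : R) ∈ tIdeal (P ⊔ C) := htop ▸ Submodule.mem_top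
  obtain ⟨A, hAP, B, hBC, hAfg, hBfg, hJAB⟩ := exists_fg_le_of_fg_le_sup hJfg hJ
  have hAB : ∀ Q : Ideal R, tIdeal Q ≤ Q → Q ≠ ⊤ → A ≤ Q → ¬ B ≤ Q := fun Q hQ hQ1 hA hB =>
    hQ1 ((Ideal.eq_top_iff_one Q).2 (hQ ⟨J, hJAB.trans (sup_le hA hB), hJfg, hJ1⟩))
  have hrad : A * B ≤ I.radical := by
    rw [← Ideal.sInf_minimalPrimes]
    refine le_sInf fun Q hQ => ?_
    by_cases hQP : Q = P
    · exact Ideal.mul_le_left.trans (hAP.trans hQP.ge)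
    · exact Ideal.mul_le_right.trans (hBC.trans (hCle Q hQ hQP))
  obtain ⟨n, hn⟩ := Ideal.exists_pow_le_of_le_radical_of_fg hrad (hAfg.mul hBfg)
  -- `A ^ (n + 1)` keeps the other minimal primes out of any `t`-maximal ideal over `X`, while `B ^
  -- (n + 1)` multiplies `X` back into `I`. The exponent is `n + 1` because `n` may be 0 and `A ^ (n
  -- + 1) ≤ P` is needed.
  set X : Ideal R := tIdeal (I ⊔ A ^ (n + 1)) with hX
  have hIX : I ≤ X := le_sup_left.trans (le_tIdeal _)
  have hAX : A ^ (n + 1) ≤ X := le_sup_right.trans (le_tIdeal _)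
  have hX0 : X ≠ ⊥ := fun h0 => hI0 (eq_bot_iff.2 (h0 ▸ hIX))
  have hXcl : tIdeal X ≤ X := tIdeal_tIdeal_le _
  have hAof : ∀ Q : Ideal R, Q.IsPrime → X ≤ Q → A ≤ Q := fun Q hQ hXQ =>
    hQ.le_of_pow_le (hAX.trans hXQ)
  have hsame : ∀ Q ∈ I.minimalPrimes, ∀ M : Ideal R, M.IsPrime → tIdeal M ≤ M → X ≤ M → Q ≤ M →
      Q = P := fun Q hQ M hM hMcl hXM hQM => by
    by_contra hne
    exact hAB M hMcl hM.ne_top (hAof M hM hXM) ((hBC.trans (hCle Q hQ hne)).trans hQM)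
  have hloc : ∀ M, IsTMaximal K M → P ≤ M → ∃ b ∉ M, ∀ x ∈ X, b * x ∈ I := by
    intro M hM hPM
    have hB : ¬ B ^ (n + 1) ≤ M := fun h =>
      hAB M hM.tIdeal_le hM.1.2 (hAP.trans hPM) (hM.isPrime.le_of_pow_le h)
    obtain ⟨b, hb, hbM⟩ := SetLike.not_le_iff_exists.1 hB
    refine ⟨b, hbM, fun x hx => mul_mem_of_mem_tIdeal hIcl (fun y hy => ?_) hx⟩
    obtain ⟨u, hu, v, hv, rfl⟩ := Submodule.mem_sup.1 hy
    rw [mul_add]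
    refine add_mem (Ideal.mul_mem_left _ _ hu) (hn (Ideal.pow_le_pow_right n.le_succ ?_))
    rw [mul_comm b v, mul_pow]
    exact Ideal.mul_mem_mul hv hb
  have hXP : X ≤ P := tIdeal_le (sup_le hP.1.2 ((Ideal.pow_le_self n.succ_ne_zero).trans hAP))
    (tIdeal_le_of_mem_minimalPrimes hIcl hP)
  have hmin : X.minimalPrimes = {P} := by
    refine Set.eq_singleton_iff_unique_mem.2 ⟨⟨⟨hPp, hXP⟩, fun Q hQ hQP =>
      hP.2 ⟨hQ.1, hIX.trans hQ.2⟩ hQP⟩, fun Q hQ => ?_⟩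
    have hQp : Q.IsPrime := hQ.1.1
    obtain ⟨Q', hQ', hle⟩ := Ideal.exists_minimalPrimes_le (hIX.trans hQ.1.2)
    obtain rfl := hsame Q' hQ' Q hQp (tIdeal_le_of_mem_minimalPrimes hXcl hQ) hQ.1.2 hle
    exact le_antisymm (hQ.2 ⟨hPp, hXP⟩ hle) hle
  have hinv : IsTInvertible K X := by
    rw [isTInvertible_iff_forall K hX0]
    intro M hM
    by_cases hXM : X ≤ M
    · have hMp := hM.isPrime
      obtain ⟨Q, hQ, hQM⟩ := Ideal.exists_minimalPrimes_le (hIX.trans hXM)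
      obtain rfl := hsame Q hQ M hMp hM.tIdeal_le hXM hQM
      obtain ⟨b, hbM, hb⟩ := hloc M hM hQM
      obtain ⟨a, ha, ha0, s, hs, hdvd⟩ := (isTInvertible_iff_forall K hI0).1 hI M hM
      refine ⟨a, hIX ha, ha0, s * b, fun h => (hMp.mem_or_mem h).elim hs hbM, fun x hx => ?_⟩
      rw [mul_assoc]
      exact hdvd _ (hb x hx)
    · obtain ⟨a, ha, haM⟩ := SetLike.not_le_iff_exists.1 hXM
      exact ⟨a, ha, fun h0 => haM (h0 ▸ zero_mem M), a, haM, fun x _ => dvd_mul_right a x⟩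
  exact ⟨X, ⟨(isTIdeal_iff K).2 ⟨hX0, hXcl⟩, hinv, hmin ▸ ⟨P, rfl, fun _ h => h⟩⟩, hmin, hIX,
    hloc⟩

/-- Both inclusions are tested at each `t`-maximal `M`: by `hsep` at most one minimal prime `P` lies
in `M`, where `X P` agrees with `I` and the other factors are not contained in `M`. -/
theorem exists_isPacketFactorization {I : Ideal R} (hIt : IsTIdeal K I) (hI : IsTInvertible K I)
    (hfin : I.minimalPrimes.Finite)
    (hsep : ∀ M, IsTMaximal K M → ∀ P ∈ I.minimalPrimes, ∀ Q ∈ I.minimalPrimes,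
      P ≤ M → Q ≤ M → P = Q) :
    ∃ s, IsPacketFactorization K I s := by
  classical
  obtain ⟨hI0, hIcl⟩ := (isTIdeal_iff K).1 hIt
  choose! X hX hmin hIX hloc using
    fun P (hP : P ∈ I.minimalPrimes) => exists_packet hIt hI hfin hsep hP
  have hmemF : ∀ P, P ∈ hfin.toFinset ↔ P ∈ I.minimalPrimes := fun P => hfin.mem_toFinset
  have hsub : ∀ P ∈ I.minimalPrimes, ∀ M : Ideal R, M.IsPrime → X P ≤ M → P ≤ M :=
    fun P hP M hM hle => (hX P hP).le_of_mem_minimalPrimes (hmin P hP ▸ rfl) hM hle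
  have hinj : ∀ P ∈ hfin.toFinset, ∀ Q ∈ hfin.toFinset, X P = X Q → P = Q := by
    intro P hP Q hQ h
    have h1 := hmin P ((hmemF P).1 hP)
    rw [h, hmin Q ((hmemF Q).1 hQ)] at h1
    exact (Set.singleton_injective h1).symm
  refine ⟨hfin.toFinset.val.map X, (isPacketFactorization_iff K).2 ⟨?_, ?_, ?_⟩⟩
  · intro Y hY
    obtain ⟨P, hP, rfl⟩ := Multiset.mem_map.1 hY
    exact hX P ((hmemF P).1 hP)
  · refine Multiset.Nodup.pairwise ?_ (Multiset.Nodup.map_on hinj hfin.toFinset.nodup)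
    intro Y hY Z hZ hne
    obtain ⟨P, hP, rfl⟩ := Multiset.mem_map.1 hY
    obtain ⟨Q, hQ, rfl⟩ := Multiset.mem_map.1 hZ
    have hP' := (hmemF P).1 hP
    have hQ' := (hmemF Q).1 hQ
    rw [tComaximal_iff]
    refine tIdeal_eq_top_of_forall K
      (fun h0 => (hX P hP').ne_bot (eq_bot_iff.2 (h0 ▸ le_sup_left))) fun M hM hle => hne ?_
    rw [hsep M hM P hP' Q hQ' (hsub P hP' M hM.isPrime (le_sup_left.trans hle))
      (hsub Q hQ' M hM.isPrime (le_sup_right.trans hle))]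
  · change tIdeal (∏ P ∈ hfin.toFinset, X P) = I
    have hprod0 : (∏ P ∈ hfin.toFinset, X P) ≠ ⊥ := by
      rw [← Ideal.zero_eq_bot]
      exact Finset.prod_ne_zero_iff.2 fun P hP => (hX P ((hmemF P).1 hP)).ne_bot
    apply le_antisymm
    · refine tIdeal_le (fun z hz => mem_of_forall_isTMaximal K hI0 hIcl fun M hM => ?_) hIcl
      by_cases hIM : I ≤ M
      · have := hM.isPrime
        obtain ⟨P, hP, hPM⟩ := Ideal.exists_minimalPrimes_le hIM
        obtain ⟨b, hbM, hb⟩ := hloc P hP M hM hPM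
        exact ⟨b, hbM, hb z ((Ideal.prod_le_inf.trans
          (Finset.inf_le ((hmemF P).2 hP))) hz)⟩
      · obtain ⟨s, hs, hsM⟩ := SetLike.not_le_iff_exists.1 hIM
        exact ⟨s, hsM, Ideal.mul_mem_right _ _ hs⟩
    · intro x hx
      refine mem_of_forall_isTMaximal K
        (fun h0 => hprod0 (eq_bot_iff.2 (h0 ▸ le_tIdeal _))) (tIdeal_tIdeal_le _) fun M hM => ?_
      by_cases hMF : ∃ P ∈ I.minimalPrimes, P ≤ M
      · obtain ⟨P, hP, hPM⟩ := hMF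
        have hrest : ¬ ∏ Q ∈ hfin.toFinset.erase P, X Q ≤ M := fun h => by
          obtain ⟨Q, hQ, hQM⟩ := hM.isPrime.prod_le.1 h
          obtain ⟨hne, hQ⟩ := Finset.mem_erase.1 hQ
          have hQ' := (hmemF Q).1 hQ
          exact hne (hsep M hM Q hQ' P hP (hsub Q hQ' M hM.isPrime hQM) hPM)
        obtain ⟨s, hs, hsM⟩ := SetLike.not_le_iff_exists.1 hrest
        refine ⟨s, hsM, le_tIdeal _ ?_⟩
        rw [← Finset.mul_prod_erase _ _ ((hmemF P).2 hP), mul_comm s x]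
        exact Ideal.mul_mem_mul (hIX P hP hx) hs
      · have hall : ¬ ∏ Q ∈ hfin.toFinset, X Q ≤ M := fun h => by
          obtain ⟨Q, hQ, hQM⟩ := hM.isPrime.prod_le.1 h
          have hQ' := (hmemF Q).1 hQ
          exact hMF ⟨Q, hQ', hsub Q hQ' M hM.isPrime hQM⟩
        obtain ⟨s, hs, hsM⟩ := SetLike.not_le_iff_exists.1 hall
        exact ⟨s, hsM, le_tIdeal _ (Ideal.mul_mem_right _ _ hs)⟩

theorem TComaximal.symm {X Y : Ideal R} (h : TComaximal K X Y) : TComaximal K Y X := by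
  rw [tComaximal_iff] at h ⊢
  rwa [sup_comm]

theorem TComaximal.not_le {X Y P : Ideal R} (h : TComaximal K X Y) (hP : tIdeal P ≤ P)
    (hP1 : P ≠ ⊤) (hX : X ≤ P) : ¬ Y ≤ P := fun hY =>
  not_le_of_tIdeal_eq_top ((tComaximal_iff K).1 h) hP hP1 (sup_le hX hY)

/-- `Multiset.Pairwise` speaks of some ordering only; symmetry of `t`-comaximality lets any factor
be moved to the front. -/
theorem IsPacketFactorization.exists_cons {I X : Ideal R} {s : Multiset (Ideal R)}
    (hs : IsPacketFactorization K I s) (hX : X ∈ s) :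
    ∃ u, s = X ::ₘ u ∧ ∀ Y ∈ u, TComaximal K X Y := by
  obtain ⟨l, rfl, hl⟩ := hs.2.1
  obtain ⟨l₁, l₂, rfl⟩ := List.append_of_mem (Multiset.mem_coe.1 hX)
  refine ⟨↑(l₁ ++ l₂), by simp, fun Y hY => ?_⟩
  rw [List.pairwise_append, List.pairwise_cons] at hl
  rcases List.mem_append.1 (Multiset.mem_coe.1 hY) with h | h
  · exact (hl.2.2 Y h X (by simp)).symm
  · exact hl.2.1.1 Y h

theorem IsPacketFactorization.nodup {I : Ideal R} {s : Multiset (Ideal R)}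
    (hs : IsPacketFactorization K I s) : s.Nodup := by
  rw [Multiset.nodup_iff_ne_cons_cons]
  rintro X u rfl
  obtain ⟨v, hv, h⟩ := hs.exists_cons (Multiset.mem_cons_self X _)
  rw [Multiset.cons_inj_right] at hv
  have hX := hs.1 X (Multiset.mem_cons_self X _)
  exact (h X (hv ▸ Multiset.mem_cons_self X u)).not_le hX.tIdeal_le hX.ne_top le_rfl le_rfl

theorem IsPacketFactorization.le {I X : Ideal R} {s : Multiset (Ideal R)}
    (hs : IsPacketFactorization K I s) (hX : X ∈ s) : I ≤ X := by
  rw [← ((isPacketFactorization_iff K).1 hs).2.2]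
  exact tIdeal_le (Ideal.multiset_prod_le_inf.trans (Multiset.inf_le hX)) (hs.1 X hX).tIdeal_le

theorem IsPacketFactorization.exists_le {I P : Ideal R} {s : Multiset (Ideal R)}
    (hs : IsPacketFactorization K I s) (hP : P.IsPrime) (hIP : I ≤ P) :
    ∃ X ∈ s, X ≤ P := by
  rw [← ((isPacketFactorization_iff K).1 hs).2.2] at hIP
  exact hP.multiset_prod_le.1 ((le_tIdeal _).trans hIP)

/-- A packet of a factorization of `I` is the smallest `t`-ideal containing `I` among those with
the same minimal prime. -/
theorem IsPacketFactorization.le_of_mem_minimalPrimes {I X Y P : Ideal R}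
    {s : Multiset (Ideal R)} (hs : IsPacketFactorization K I s) (hX : X ∈ s) (hY : IsPacket K Y)
    (hIY : I ≤ Y) (hPX : P ∈ X.minimalPrimes) (hPY : P ∈ Y.minimalPrimes) : X ≤ Y := by
  intro x hx
  obtain ⟨u, rfl, hu⟩ := hs.exists_cons hX
  refine mem_of_forall_isTMaximal K hY.ne_bot hY.tIdeal_le fun M hM => ?_
  by_cases hYM : Y ≤ M
  · have hXM := hPX.1.2.trans (hY.le_of_mem_minimalPrimes hPY hM.isPrime hYM)
    have hrest : ¬ u.prod ≤ M := fun h => by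
      obtain ⟨Z, hZ, hZM⟩ := hM.isPrime.multiset_prod_le.1 h
      exact (hu Z hZ).not_le hM.tIdeal_le hM.1.2 hXM hZM
    obtain ⟨r, hr, hrM⟩ := SetLike.not_le_iff_exists.1 hrest
    refine ⟨r, hrM, hIY ?_⟩
    rw [← ((isPacketFactorization_iff K).1 hs).2.2, mul_comm, Multiset.prod_cons]
    exact le_tIdeal _ (Ideal.mul_mem_mul hx hr)
  · obtain ⟨r, hr, hrM⟩ := SetLike.not_le_iff_exists.1 hYM
    exact ⟨r, hrM, Ideal.mul_mem_right _ _ hr⟩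

/-- Going from `X` to `Y ∈ s'` and back to `Z ∈ s` only shrinks the prime. Both `Z` and `X` lie in
the `t`-closed prime `P`, so comaximality gives `Z = X`; hence `X` and `Y` share their minimal prime
and contain each other. -/
theorem IsPacketFactorization.subset {I : Ideal R} {s s' : Multiset (Ideal R)}
    (hs : IsPacketFactorization K I s) (hs' : IsPacketFactorization K I s') : s ⊆ s' := by
  intro X hX
  have hXp := hs.1 X hX
  obtain ⟨P, hP, -⟩ := hXp.2.2
  obtain ⟨Y, hY, hYP⟩ := hs'.exists_le hP.1.1 ((hs.le hX).trans hP.1.2)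
  have hYp := hs'.1 Y hY
  obtain ⟨Q, hQ, -⟩ := hYp.2.2
  have hQP : Q ≤ P := hYp.le_of_mem_minimalPrimes hQ hP.1.1 hYP
  obtain ⟨Z, hZ, hZQ⟩ := hs.exists_le hQ.1.1 ((hs'.le hY).trans hQ.1.2)
  obtain ⟨u, rfl, hu⟩ := hs.exists_cons hX
  have hPt := tIdeal_le_of_mem_minimalPrimes hXp.tIdeal_le hP
  have hPp : P.IsPrime := hP.1.1
  obtain rfl : Z = X := (Multiset.mem_cons.1 hZ).resolve_right fun hZu =>
    (hu Z hZu).not_le hPt hPp.ne_top hP.1.2 (hZQ.trans hQP)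
  obtain rfl : Q = P := le_antisymm hQP (hP.2 ⟨hQ.1.1, hZQ⟩ hQP)
  have hXY : Z = Y := le_antisymm (hs.le_of_mem_minimalPrimes hX hYp (hs'.le hY) hP hQ)
    (hs'.le_of_mem_minimalPrimes hY hXp (hs.le hX) hQ hP)
  exact hXY ▸ hY

theorem IsPacketFactorization.unique {I : Ideal R} {s s' : Multiset (Ideal R)}
    (hs : IsPacketFactorization K I s) (hs' : IsPacketFactorization K I s') : s = s' :=
  (Multiset.Nodup.ext hs.nodup hs'.nodup).2 fun _ => ⟨fun h => hs.subset hs' h,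
    fun h => hs'.subset hs h⟩

end Factorization

/-! ### The three classes of domains -/

section Main

variable {R : Type*} [CommRing R] [IsDomain R]
variable {K : Type*} [Field K] [Algebra R K] [IsFractionRing R K]

/-- An ideal lying between a product of packets and each of the factors has finitely many minimal
primes. -/
theorem finite_minimalPrimes_of_packets {I : Ideal R} {s : Multiset (Ideal R)}
    (hs : ∀ J ∈ s, IsPacket K J) (hprod : s.prod ≤ I) (hle : ∀ J ∈ s, I ≤ J) :
    I.minimalPrimes.Finite := by
  classical
  choose! p hp using fun J (hJ : J ∈ s) => (hs J hJ).2.2.exists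
  refine (s.toFinset.image p).finite_toSet.subset fun P hP => ?_
  have hPp : P.IsPrime := hP.1.1
  obtain ⟨J, hJ, hJP⟩ := hPp.multiset_prod_le.1 (hprod.trans hP.1.2)
  have h1 : p J ≤ P := (hs J hJ).le_of_mem_minimalPrimes (hp J hJ) hPp hJP
  have h2 : P ≤ p J := hP.2 ⟨(hp J hJ).1.1, (hle J hJ).trans (hp J hJ).1.2⟩ h1
  rw [le_antisymm h2 h1]
  simpa using ⟨J, hJ, rfl⟩

theorem IsURD.finite_minimalPrimes (h : IsURD R K) {x : R} (hx : x ≠ 0) :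
    (Ideal.span {x} : Ideal R).minimalPrimes.Finite := by
  by_cases hu : IsUnit x
  · rw [Ideal.span_singleton_eq_top.2 hu, Ideal.minimalPrimes_top]
    exact Set.finite_empty
  · obtain ⟨s, hs, -⟩ := h _ (isTIdeal_span_singleton K hx) (isTInvertible_span_singleton K hx)
      (fun h => hu (Ideal.span_singleton_eq_top.1 h))
    exact finite_minimalPrimes_of_packets hs.1
      (((isPacketFactorization_iff K).1 hs).2.2 ▸ le_tIdeal _) fun J hJ => hs.le hJ

theorem IsPVMD.isURD (hR : IsPVMD R K)
    (h : ∀ x : R, x ≠ 0 → (Ideal.span {x} : Ideal R).minimalPrimes.Finite) : IsURD R K := by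
  intro I hIt hI _
  obtain ⟨F, hF, hsub⟩ := minimalPrimes_subset_of_isTInvertible K hIt hI
  have hfin : I.minimalPrimes.Finite :=
    (F.finite_toSet.biUnion fun a ha => h a (hF a ha)).subset hsub
  obtain ⟨s, hs⟩ := exists_isPacketFactorization hIt hI hfin fun M hM P hP Q hQ hPM hQM =>
    have := hM.isPrime
    hR.eq_of_mem_minimalPrimes K hM.tIdeal_le hP hQ hPM hQM
  exact ⟨s, hs, fun s' hs' => hs'.unique hs⟩

theorem IsKrullType.finite_minimalPrimes (hR : IsKrullType R K) {x : R} (hx : x ≠ 0) :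
    (Ideal.span {x} : Ideal R).minimalPrimes.Finite := by
  have hcl := tIdeal_span_singleton_le x
  have key : ∀ P ∈ (Ideal.span {x} : Ideal R).minimalPrimes, ∃ M, IsTMaximal K M ∧ P ≤ M := by
    intro P hP
    have hPp : P.IsPrime := hP.1.1
    have hxP : x ∈ P := (Ideal.span_singleton_le_iff_mem P).1 hP.1.2
    exact exists_isTMaximal_ge K (fun h0 => hx (by simpa [h0] using hxP))
      fun h => hPp.ne_top (top_le_iff.1 (h ▸ tIdeal_le_of_mem_minimalPrimes hcl hP))
  choose! m hm hle using key
  refine Set.Finite.of_finite_image ((hR.2 x hx).subset ?_) (f := m) ?_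
  · rintro _ ⟨P, hP, rfl⟩
    exact ⟨hm P hP, hle P hP ((Ideal.span_singleton_le_iff_mem P).1 hP.1.2)⟩
  · intro P hP Q hQ h
    have := (hm P hP).isPrime
    exact hR.1.eq_of_mem_minimalPrimes K (hm P hP).tIdeal_le hP hQ (hle P hP) (h ▸ hle Q hQ)

variable (R K) in
-- The cofactors `b a` of a gcd `g` generate an ideal with `v`-closure `R`, so `M` omits some `b a`;
-- since `b a * y = a * b y`, the element `a` generates locally.
theorem isPVMD_of_isGCDMonoid [IsGCDMonoid R] : IsPVMD R K := by
  classical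
  rintro I hI ⟨F, rfl⟩
  rw [isTInvertible_iff_forall K hI]
  intro M hM
  obtain ⟨g, hg, hg'⟩ := exists_gcd_mem_vIdeal F
  have hg0 : g ≠ 0 := by
    rintro rfl
    refine hI (Ideal.span_eq_bot.2 fun a ha => zero_dvd_iff.1 (hg a ha))
  choose! b hb using hg
  have hex : ∃ a ∈ F, b a ∉ M := by
    by_contra! hcon
    refine hM.1.2 ((Ideal.eq_top_iff_one M).2 (hM.tIdeal_le
      ⟨Ideal.span (F.image b), ?_, ⟨_, rfl⟩, fun c d h => ?_⟩))
    · rw [Ideal.span_le]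
      intro y hy
      obtain ⟨a, ha, rfl⟩ := Finset.mem_image.1 (Finset.mem_coe.1 hy)
      exact hcon a ha
    · have h1 := hg' c (g * d) fun a ha => by
        rw [hb a ha, mul_left_comm]
        exact mul_dvd_mul_left g (h _ (Ideal.subset_span (by
          exact_mod_cast Finset.mem_image_of_mem b ha)))
      rw [mul_comm c g] at h1
      simpa using (mul_dvd_mul_iff_left hg0).1 h1
  obtain ⟨a, ha, haM⟩ := hex
  refine ⟨a, Ideal.subset_span ha, fun h0 => ?_, b a, haM, fun x hx => ?_⟩
  · have hb0 : b a = 0 := (mul_eq_zero.1 ((hb a ha).symm.trans h0)).resolve_left hg0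
    exact haM (hb0 ▸ zero_mem M)
  · refine Submodule.span_induction (fun y hy => ?_) (by simp) (fun u v _ _ hu hv => ?_)
      (fun r u _ hu => ?_) hx
    · have h1 := hb a ha
      have h2 := hb y hy
      refine ⟨b y, ?_⟩
      linear_combination b a * h2 - b y * h1
    · rw [mul_add]
      exact dvd_add hu hv
    · rw [smul_eq_mul, mul_left_comm]
      exact hu.mul_left r

/-- The generator is a gcd of the finite set of local generators: it lies in `I` by closure, and it
divides each local generator. -/
theorem exists_eq_span_singleton [IsGCDMonoid R] {I : Ideal R} (hIt : IsTIdeal K I)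
    (hI : IsTInvertible K I) : ∃ g : R, I = Ideal.span {g} := by
  obtain ⟨hI0, hIcl⟩ := (isTIdeal_iff K).1 hIt
  obtain ⟨F, hF, hloc⟩ := hI.exists_finset
  obtain ⟨g, hg, hg'⟩ := exists_gcd_mem_vIdeal F
  have hgI : g ∈ I := hIcl ⟨Ideal.span F, Ideal.span_le.2 fun a ha => (hF a ha).1, ⟨F, rfl⟩,
    fun c d h => hg' c d fun a ha => h a (Ideal.subset_span ha)⟩
  refine ⟨g, le_antisymm (fun x hx => ?_) ((Ideal.span_singleton_le_iff_mem I).2 hgI)⟩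
  by_cases hg0 : g = 0
  · exfalso
    subst hg0
    have hbot : (⊥ : Ideal R) ≠ ⊤ := bot_ne_top
    -- Testing at the zero ideal shows that `F` is nonempty.
    obtain ⟨a, ha, -⟩ := hloc ⊥ (by
      rintro y ⟨J, hJ, -, hy⟩
      rw [le_bot_iff.1 hJ, vIdeal_bot] at hy
      exact hy) hbot
    exact (hF a ha).2 (zero_dvd_iff.1 (hg a ha))
  · refine mem_of_forall_isTMaximal K (by simpa using hg0) (tIdeal_span_singleton_le g)
      fun M hM => ?_
    obtain ⟨a, ha, s, hs, hdvd⟩ := hloc M hM.tIdeal_le hM.1.2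
    exact ⟨s, hs, Ideal.mem_span_singleton.2 ((hg a ha).trans (hdvd x hx))⟩

/-- The packets are principal, so their product is principal and already `t`-closed. -/
theorem IsPacketFactorization.prod_eq [IsGCDMonoid R] {I : Ideal R} {s : Multiset (Ideal R)}
    (hs : IsPacketFactorization K I s) : s.prod = I := by
  have hprin : ∀ t : Multiset (Ideal R), (∀ J ∈ t, IsPacket K J) →
      ∃ g : R, t.prod = Ideal.span {g} := by
    intro t
    induction t using Multiset.induction_on with
    | empty => exact fun _ => ⟨1, by simp⟩
    | cons J t ih =>
      intro h
      obtain ⟨g, hg⟩ := ih fun L hL => h L (Multiset.mem_cons_of_mem hL)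
      have hJ := h J (Multiset.mem_cons_self J t)
      obtain ⟨a, rfl⟩ := exists_eq_span_singleton hJ.1 hJ.2.1
      exact ⟨a * g, by rw [Multiset.prod_cons, hg, Ideal.span_singleton_mul_span_singleton]⟩
  obtain ⟨g, hg⟩ := hprin s hs.1
  rw [← ((isPacketFactorization_iff K).1 hs).2.2, hg]
  exact le_antisymm (le_tIdeal _) (tIdeal_span_singleton_le g)

end Main

end TFactor

theorem theoremC (R : Type*) [CommRing R] [IsDomain R]
    (K : Type*) [Field K] [Algebra R K] [IsFractionRing R K] :
    (TFactor.IsPVMD R K →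
      (TFactor.IsURD R K ↔
        ∀ x : R, x ≠ 0 → (Ideal.span {x} : Ideal R).minimalPrimes.Finite)) ∧
    (TFactor.IsKrullType R K → TFactor.IsURD R K) ∧
    (IsGCDMonoid R →
      (TFactor.IsURD R K ↔
        ∀ x : R, x ≠ 0 → ¬ IsUnit x →
          ∃ s : Multiset (Ideal R),
            (∀ J ∈ s, TFactor.IsPacket K J) ∧ s.prod = Ideal.span {x})) := by
  refine ⟨fun hR => ⟨fun h x hx => h.finite_minimalPrimes hx, hR.isURD⟩,
    fun hR => hR.1.isURD fun x hx => hR.finite_minimalPrimes hx, fun hR => ⟨fun h x hx hu => ?_,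
      fun h => (TFactor.isPVMD_of_isGCDMonoid R K).isURD fun x hx => ?_⟩⟩
  · obtain ⟨s, hs, -⟩ := h _ (TFactor.isTIdeal_span_singleton K hx)
      (TFactor.isTInvertible_span_singleton K hx)
      (fun h => hu (Ideal.span_singleton_eq_top.1 h))
    exact ⟨s, hs.1, hs.prod_eq⟩
  · by_cases hu : IsUnit x
    · rw [Ideal.span_singleton_eq_top.2 hu, Ideal.minimalPrimes_top]
      exact Set.finite_empty
    · obtain ⟨s, hs, hprod⟩ := h x hx hu
      refine TFactor.finite_minimalPrimes_of_packets hs hprod.le fun J hJ => ?_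
      rw [← hprod]
      exact Ideal.multiset_prod_le_inf.trans (Multiset.inf_le hJ)
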